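/- Let $\mathbb{N}=\{1,2,\ldots\}$, let $d$ be a positive integer, and let $(\tau_1,\ldots,\tau_d)$ be an $\mathbb{N}^d$-valued random vector with distribution $\mu$. Assume: (a) $\mu$ is a multivariate geometric distribution, in the sense that at least one of the following holds. - $\mu$ has the local discrete lack-of-memory property: for every non-empty $S\subseteq\{1,\ldots,d\}$ and all $m,n_i\in\{0,1,2,\ldots\}$ ($i\in S$), $$\mathbb{P}(\tau_i>n_i+m\ \forall i\in S\mid \tau_i>m\ \forall i\in S)=\mathbb{P}(\tau_i>n_i\ \forall i\in S)$$ whenever the conditioning event has positive probability. - $\mu$ is wide-sense geometric: there are $\tilde p_I\ge 0$, $I\subseteq\{1,\ldots,d\}$, with $\sum_I\tilde p_I=1$ and $\sum_{I\not\ni k}\tilde p_I<1$ for all $k$, such that $\mu$ is the law of $(\min_{I\ni k}\widetilde E_I)_{k=1}^d$, where $\widetilde E_I$ is the number of the first trial with outcome $I$ in a sequence of i.i.d. trials in which outcome $I$ has probability $\tilde p_I$. - $\mu$ is narrow-sense geometric: there are $p_I\in[0,1]$, $\emptyset\ne I\subseteq\{1,\ldots,d\}$, with $\prod_{I\ni k}p_I<1$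 for all $k$, such that $\mu$ is the law of $(\min_{I\ni k}E_I)_{k=1}^d$ for independent $E_I$ with $\mathbb{P}(E_I>n)=p_I^n$ for $n\in\{0,1,2,\ldots\}$ (so $E_I=\infty$ almost surely if $p_I=1$). (b) $\mu$ is extendible: there is an infinite exchangeable sequence of $\mathbb{N}$-valued random variables whose first $d$ members have joint law $\mu$. Then $(\tau_1,\ldots,\tau_d)$ is multivariate right tail increasing (MRTI): for every permutation $\pi$ of $\{1,\ldots,d\}$, every $i\in\{2,\ldots,d\}$ and every $n_i\in\{0,1,2,\ldots\}$, the conditional probability $$\mathbb{P}(\tau_{\pi(i)}>n_i\mid \tau_{\pi(1)}>n_1,\ldots,\tau_{\pi(i-1)}>n_{i-1})$$ is non-decreasing in $n_1,\ldots,n_{i-1}\in\{0,1,2,\ldots\}$, on the set of those arguments for which the conditioning event has positive probability. -/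

import Mathlib

open MeasureTheory ProbabilityTheory
open scoped NNReal ENNReal

namespace MultGeom

/-- Every set of positive integers is measurable. -/
instance instMeasurableSpacePNat : MeasurableSpace ℕ+ := ⊤

instance instDiscreteMeasurableSpacePNat : DiscreteMeasurableSpace ℕ+ := ⟨fun _ => trivial⟩

/-- The event `x i > n i` for all `i ∈ S`. -/
def survivalEvent {d : ℕ} (S : Finset (Fin d)) (n : Fin d → ℕ) : Set (Fin d → ℕ+) :=
  {x | ∀ i ∈ S, n i < (x i : ℕ)}

/-- The local discrete multivariate lack-of-memory property of a distribution on `ℕ^d`,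
`ℕ = {1, 2, …}`: for every non-empty set `S` of coordinates and all `m, n_i ∈ {0, 1, 2, …}`,
`P(τ_i > n_i + m, i ∈ S | τ_i > m, i ∈ S) = P(τ_i > n_i, i ∈ S)`
whenever the conditioning event has positive probability. -/
def LocalLackOfMemory {d : ℕ} (μ : Measure (Fin d → ℕ+)) : Prop :=
  ∀ S : Finset (Fin d), S.Nonempty → ∀ (n : Fin d → ℕ) (m : ℕ),
    μ (survivalEvent S fun _ => m) ≠ 0 →
      (μ[|survivalEvent S fun _ => m]) (survivalEvent S fun i => n i + m) =
        μ (survivalEvent S n)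

/-- The number (`1, 2, …`) of the first of the trials `X 0, X 1, …` with outcome `I`;
it is `∞` if `I` never occurs. -/
noncomputable def firstTrial {Ω : Type} {d : ℕ} (X : ℕ → Ω → Finset (Fin d))
    (I : Finset (Fin d)) (ω : Ω) : ℕ∞ :=
  ⨅ (n : ℕ) (_ : X n ω = I), ((n + 1 : ℕ) : ℕ∞)

/-- The multivariate wide-sense geometric distribution with parameters `p I`, `I ⊆ {1, …, d}`:
an experiment with outcomes `I`, having probabilities `p I`, is repeated independently, and `μ` is
the law of the vector whose `k`-th component is the minimum over all `I ∋ k` of the number of the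
trial which first yields `I`. -/
def IsWideSenseGeometricWith {d : ℕ} (p : Finset (Fin d) → ℝ≥0)
    (μ : Measure (Fin d → ℕ+)) : Prop :=
  ∑ I, p I = 1 ∧
  (∀ k : Fin d, ∑ I with k ∉ I, p I < 1) ∧
  ∃ (Ω : Type) (_ : MeasurableSpace Ω) (P : Measure Ω) (X : ℕ → Ω → Finset (Fin d)),
    IsProbabilityMeasure P ∧
    (∀ n, Measurable (X n)) ∧
    iIndepFun X P ∧
    (∀ n I, P {ω | X n ω = I} = p I) ∧
    ∀ x : Fin d → ℕ+,
      μ {x} = P {ω | ∀ k, ⨅ (I : Finset (Fin d)) (_ : k ∈ I), firstTrial X I ω = ((x k : ℕ) : ℕ∞)}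

/-- `μ` is a multivariate wide-sense geometric distribution, for some admissible parameters. -/
def IsWideSenseGeometric {d : ℕ} (μ : Measure (Fin d → ℕ+)) : Prop :=
  ∃ p : Finset (Fin d) → ℝ≥0, IsWideSenseGeometricWith p μ

/-- The multivariate narrow-sense geometric distribution with parameters `p I`,
`∅ ≠ I ⊆ {1, …, d}`: the law of the vector `(min {E I : k ∈ I})_k` for independent shocks `E I` that
are geometric with `P(E I > n) = (p I) ^ n` (so that `E I = ∞` almost surely if `p I = 1`). -/
def IsNarrowSenseGeometricWith {d : ℕ} (p : {I : Finset (Fin d) // I.Nonempty} → ℝ≥0)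
    (μ : Measure (Fin d → ℕ+)) : Prop :=
  (∀ I, p I ≤ 1) ∧
  (∀ k : Fin d, ∏ I with k ∈ I.1, p I < 1) ∧
  ∃ (Ω : Type) (_ : MeasurableSpace Ω) (P : Measure Ω)
    (E : {I : Finset (Fin d) // I.Nonempty} → Ω → ℕ∞),
    IsProbabilityMeasure P ∧
    (∀ I, Measurable (E I)) ∧
    iIndepFun E P ∧
    (∀ I (n : ℕ), P {ω | (n : ℕ∞) < E I ω} = (p I : ℝ≥0∞) ^ n) ∧
    ∀ x : Fin d → ℕ+,
      μ {x} = P {ω | ∀ k, ⨅ (I : {I : Finset (Fin d) // I.Nonempty}) (_ : k ∈ I.1), E I ω =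
        ((x k : ℕ) : ℕ∞)}

/-- `μ` is a multivariate narrow-sense geometric distribution, for some admissible parameters. -/
def IsNarrowSenseGeometric {d : ℕ} (μ : Measure (Fin d → ℕ+)) : Prop :=
  ∃ p : {I : Finset (Fin d) // I.Nonempty} → ℝ≥0, IsNarrowSenseGeometricWith p μ

/-- The law `ν` of an infinite sequence is exchangeable: it is invariant under all permutations of
finitely many indices. -/
def IsExchangeableSeq (ν : Measure (ℕ → ℕ+)) : Prop :=
  ∀ σ : Equiv.Perm ℕ, {i | σ i ≠ i}.Finite → ν.map (fun x i => x (σ i)) = ν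

/-- `μ` is extendible: it is the law of the first `d` members of an infinite exchangeable
sequence. -/
def IsExtendible {d : ℕ} (μ : Measure (Fin d → ℕ+)) : Prop :=
  ∃ ν : Measure (ℕ → ℕ+), IsProbabilityMeasure ν ∧ IsExchangeableSeq ν ∧
    ν.map (fun x (i : Fin d) => x i) = μ

/-- The event `x (π j) > n j` for all `j < i`, that is, `τ_{π(1)} > n_1, …, τ_{π(i-1)} > n_{i-1}`. -/
def tailEvent {d : ℕ} (π : Equiv.Perm (Fin d)) (i : Fin d) (n : Fin d → ℕ) : Set (Fin d → ℕ+) :=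
  {x | ∀ j < i, n j < (x (π j) : ℕ)}

/-- Multivariate right tail increasing (MRTI) positive dependence: for every permutation `π`, every
`i ∈ {2, …, d}` and every `n_i ∈ {0, 1, 2, …}`, the conditional probability
`P(τ_{π(i)} > n_i | τ_{π(1)} > n_1, …, τ_{π(i-1)} > n_{i-1})` is non-decreasing in
`n_1, …, n_{i-1}`, on the set of those arguments for which the conditioning event has positive
probability. In Lean the indices start at `0`. -/
def IsMRTI {d : ℕ} (μ : Measure (Fin d → ℕ+)) : Prop :=
  ∀ (π : Equiv.Perm (Fin d)) (i : Fin d), 0 < (i : ℕ) → ∀ (k : ℕ) (n n' : Fin d → ℕ),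
    (∀ j < i, n j ≤ n' j) → μ (tailEvent π i n') ≠ 0 →
      (μ[|tailEvent π i n]) {x | k < (x (π i) : ℕ)} ≤
        (μ[|tailEvent π i n']) {x | k < (x (π i) : ℕ)}

end MultGeom

namespace MultGeom

/-! All three kinds of geometric law enter only through `SurvivalFactorizes`: the survival function
splits into a first-time-step factor and its value at the thresholds lowered by one. Under
extendibility that factor depends only on the number of positive thresholds; it is some `b c`, the
probability that `c` members of the sequence exceed 1. Exchangeability makes `b` log-convex
(`IsExchangeableSeq.sq_le`), so `b (c + 1) / b c` grows with `c`. MRTI, cross-multiplied, then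
follows by induction on the new threshold, one time step at a time (`survival_update_mul_le`). -/

/-! ### Log-convexity from infinite exchangeability. -/

theorem exists_perm_finite_map_eq {S T : Finset ℕ} (h : S.card = T.card) :
    ∃ σ : Equiv.Perm ℕ, {i | σ i ≠ i}.Finite ∧ ∀ i, i ∈ S ↔ σ i ∈ T := by
  classical
  let U := {x // x ∈ S ∪ T}
  have hc : Fintype.card {x : U // x.1 ∈ S} = Fintype.card {x : U // x.1 ∈ T} := by
    have e1 : {x : U // x.1 ∈ S} ≃ {x // x ∈ S} :=
      Equiv.subtypeSubtypeEquivSubtype fun hx => Finset.mem_union_left _ hx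
    have e2 : {x : U // x.1 ∈ T} ≃ {x // x ∈ T} :=
      Equiv.subtypeSubtypeEquivSubtype fun hx => Finset.mem_union_right _ hx
    rw [Fintype.card_congr e1, Fintype.card_congr e2]
    simpa using h
  let e := Fintype.equivOfCardEq hc
  let τ : Equiv.Perm U := e.extendSubtype
  refine ⟨Equiv.Perm.ofSubtype τ, ?_, ?_⟩
  · refine (S ∪ T).finite_toSet.subset fun i hi => ?_
    by_contra hn
    exact hi (Equiv.Perm.ofSubtype_apply_of_not_mem τ hn)
  · intro i
    by_cases hi : i ∈ S ∪ T
    · rw [Equiv.Perm.ofSubtype_apply_of_mem τ hi]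
      constructor
      · intro hS
        exact e.extendSubtype_mem ⟨i, hi⟩ hS
      · intro hT
        by_contra hS
        exact e.extendSubtype_not_mem ⟨i, hi⟩ hS hT
    · rw [Equiv.Perm.ofSubtype_apply_of_not_mem τ hi]
      simp only [Finset.mem_union, not_or] at hi
      tauto

/-- The event that all members of the sequence with index in `S` exceed `1`. -/
def exceedOne (S : Finset ℕ) : Set (ℕ → ℕ+) := {x | ∀ i ∈ S, 1 < (x i : ℕ)}

theorem measurableSet_exceedOne (S : Finset ℕ) : MeasurableSet (exceedOne S) := by
  have : exceedOne S = ⋂ i ∈ S, (fun x : ℕ → ℕ+ => x i) ⁻¹' {a | 1 < (a : ℕ)} := by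
    ext x; simp [exceedOne]
  rw [this]
  exact Finset.measurableSet_biInter _ fun i _ =>
    measurable_pi_apply i (MeasurableSet.of_discrete)

theorem IsExchangeableSeq.measure_exceedOne {ν : Measure (ℕ → ℕ+)} (hν : IsExchangeableSeq ν)
    {S T : Finset ℕ} (h : S.card = T.card) : ν (exceedOne S) = ν (exceedOne T) := by
  obtain ⟨σ, hfin, hσ⟩ := exists_perm_finite_map_eq h.symm
  have hm : Measurable (fun (x : ℕ → ℕ+) i => x (σ i)) :=
    measurable_pi_lambda _ fun i => measurable_pi_apply _
  conv_rhs => rw [← hν σ hfin, Measure.map_apply hm (measurableSet_exceedOne T)]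
  congr 1
  ext x
  change (∀ i ∈ S, 1 < (x i : ℕ)) ↔ ∀ i ∈ T, 1 < (x (σ i) : ℕ)
  constructor
  · intro hx i hi
    exact hx (σ i) ((hσ i).1 hi)
  · intro hx i hi
    simpa using hx (σ.symm i) ((hσ _).2 (by simpa using hi))

theorem IsExchangeableSeq.measureReal_exceedOne {ν : Measure (ℕ → ℕ+)} (hν : IsExchangeableSeq ν)
    (S : Finset ℕ) : ν.real (exceedOne S) = ν.real (exceedOne (Finset.range S.card)) := by
  rw [measureReal_def, measureReal_def, hν.measure_exceedOne (Finset.card_range _).symm]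

theorem indicator_exceedOne_mul (R : Finset ℕ) (t : ℝ) (i j : ℕ) (x : ℕ → ℕ+) :
    (t * (exceedOne R).indicator 1 x - (exceedOne (insert i R)).indicator 1 x) *
      (t * (exceedOne R).indicator 1 x - (exceedOne (insert j R)).indicator 1 x) =
    t ^ 2 * (exceedOne R).indicator 1 x - t * (exceedOne (insert i R)).indicator 1 x
      - t * (exceedOne (insert j R)).indicator 1 x
      + (exceedOne (insert i (insert j R))).indicator 1 x := by
  by_cases hR : x ∈ exceedOne R
  · have h : ∀ {l : ℕ}, x ∈ exceedOne (insert l R) ↔ 1 < (x l : ℕ) := fun {l} =>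
      ⟨fun hx => hx l (Finset.mem_insert_self _ _), fun hl k hk => by
        rcases Finset.mem_insert.1 hk with rfl | hk
        exacts [hl, hR k hk]⟩
    have h2 : x ∈ exceedOne (insert i (insert j R)) ↔ 1 < (x i : ℕ) ∧ 1 < (x j : ℕ) :=
      ⟨fun hx => ⟨hx i (by simp), hx j (by simp)⟩, fun hl k hk => by
        rcases Finset.mem_insert.1 hk with rfl | hk
        · exact hl.1
        · rcases Finset.mem_insert.1 hk with rfl | hk
          exacts [hl.2, hR k hk]⟩
    simp only [Set.indicator, hR, h, h2, if_true, Pi.one_apply]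
    by_cases hi : 1 < (x i : ℕ) <;> by_cases hj : 1 < (x j : ℕ) <;> simp [hi, hj] <;> ring
  · have h : ∀ {Q : Finset ℕ}, R ⊆ Q → x ∉ exceedOne Q := fun hQ hx =>
      hR fun k hk => hx k (hQ hk)
    have h1 : ∀ l, x ∉ exceedOne (insert l R) := fun l => h (Finset.subset_insert _ _)
    have h2 : x ∉ exceedOne (insert i (insert j R)) :=
      h ((Finset.subset_insert _ _).trans (Finset.subset_insert _ _))
    simp [hR, h1, h2]

/-- This is the second moment of `∑ i < N, (t * 1_R - 1_{R ∪ {k + i}})` with `R = range k`. Each of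
the `N ^ 2` pairs contributes the same quadratic in `t`, and the `N` diagonal pairs add a correction
of lower order in `N`. -/
theorem IsExchangeableSeq.quadratic_nonneg {ν : Measure (ℕ → ℕ+)} [IsProbabilityMeasure ν]
    (hν : IsExchangeableSeq ν) (k N : ℕ) (t : ℝ) :
    0 ≤ (N : ℝ) ^ 2 * (t ^ 2 * ν.real (exceedOne (Finset.range k))
        - 2 * t * ν.real (exceedOne (Finset.range (k + 1)))
        + ν.real (exceedOne (Finset.range (k + 2))))
      + N * (ν.real (exceedOne (Finset.range (k + 1)))
        - ν.real (exceedOne (Finset.range (k + 2)))) := by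
  let g : Finset ℕ → (ℕ → ℕ+) → ℝ := fun S => (exceedOne S).indicator 1
  let R := Finset.range k
  have hg : ∀ S, ∫ x, g S x ∂ν = ν.real (exceedOne (Finset.range S.card)) := fun S => by
    rw [← hν.measureReal_exceedOne S]
    exact integral_indicator_one (measurableSet_exceedOne S)
  have hgi : ∀ S, Integrable (g S) ν := fun S =>
    (integrable_const (1 : ℝ)).indicator (measurableSet_exceedOne S)
  have h0 : 0 ≤ ∫ x, (∑ i ∈ Finset.range N, (t * g R x - g (insert (k + i) R) x)) ^ 2 ∂ν :=
    integral_nonneg fun x => sq_nonneg _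
  have hsq : ∀ x, (∑ i ∈ Finset.range N, (t * g R x - g (insert (k + i) R) x)) ^ 2 =
      ∑ i ∈ Finset.range N, ∑ j ∈ Finset.range N, (t ^ 2 * g R x - t * g (insert (k + i) R) x
        - t * g (insert (k + j) R) x + g (insert (k + i) (insert (k + j) R)) x) := fun x => by
    rw [sq, Finset.sum_mul_sum]
    exact Finset.sum_congr rfl fun i _ => Finset.sum_congr rfl fun j _ =>
      indicator_exceedOne_mul R t _ _ x
  have hi1 : ∀ i j, Integrable (fun x => t ^ 2 * g R x - t * g (insert (k + i) R) x
        - t * g (insert (k + j) R) x + g (insert (k + i) (insert (k + j) R)) x) ν := fun i j =>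
    ((((hgi _).const_mul _).sub ((hgi _).const_mul _)).sub ((hgi _).const_mul _)).add (hgi _)
  have hR : ∀ i, k + i ∉ R := fun i => by simp [R]
  have hint : ∀ i j, ∫ x, (t ^ 2 * g R x - t * g (insert (k + i) R) x
        - t * g (insert (k + j) R) x + g (insert (k + i) (insert (k + j) R)) x) ∂ν =
      (t ^ 2 * ν.real (exceedOne (Finset.range k))
        - 2 * t * ν.real (exceedOne (Finset.range (k + 1)))
        + ν.real (exceedOne (Finset.range (k + 2)))) +
      if i = j then (ν.real (exceedOne (Finset.range (k + 1)))
        - ν.real (exceedOne (Finset.range (k + 2)))) else 0 := fun i j => by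
    have hc1 : ∀ (c : ℝ) S, Integrable (fun x => c * g S x) ν := fun c S => (hgi S).const_mul c
    have hs : Integrable (fun x => t ^ 2 * g R x - t * g (insert (k + i) R) x) ν :=
      (hc1 _ _).sub (hc1 _ _)
    have hs' : Integrable (fun x => t ^ 2 * g R x - t * g (insert (k + i) R) x
        - t * g (insert (k + j) R) x) ν := hs.sub (hc1 _ _)
    rw [integral_add hs' (hgi _), integral_sub hs (hc1 _ _), integral_sub (hc1 _ _) (hc1 _ _)]
    simp only [integral_const_mul, hg]
    rw [Finset.card_insert_of_notMem (hR i), Finset.card_insert_of_notMem (hR j)]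
    have hc : R.card = k := Finset.card_range k
    split_ifs with hij
    -- On the diagonal the two insertions coincide: the joint event has `k + 1` indices instead of
    -- `k + 2`.
    · subst hij
      rw [Finset.insert_idem, Finset.card_insert_of_notMem (hR i), hc]
      ring
    · have : k + i ∉ insert (k + j) R := by
        simp only [Finset.mem_insert, not_or]
        exact ⟨by omega, hR i⟩
      rw [Finset.card_insert_of_notMem this, Finset.card_insert_of_notMem (hR j), hc]
      ring
  simp_rw [hsq] at h0
  rw [integral_finsetSum _ fun i _ => integrable_finsetSum _ fun j _ => hi1 i j] at h0
  rw [Finset.sum_congr rfl fun i _ => integral_finsetSum _ fun j _ => hi1 i j] at h0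
  simp_rw [hint, Finset.sum_add_distrib] at h0
  refine h0.trans_eq ?_
  have hdiag : ∀ c : ℝ, ∑ i ∈ Finset.range N, ∑ j ∈ Finset.range N, (if i = j then c else 0) =
      N * c := fun c => by
    rw [Finset.sum_congr rfl fun i hi => by
      rw [Finset.sum_ite_eq, if_pos hi]]
    simp
  rw [hdiag]
  simp only [Finset.sum_const, Finset.card_range, nsmul_eq_mul]
  ring

theorem nonneg_of_forall_sq_mul_add_nonneg {a b : ℝ} (h : ∀ N : ℕ, 0 ≤ (N : ℝ) ^ 2 * a + N * b) :
    0 ≤ a := by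
  by_contra! ha
  obtain ⟨N, hN⟩ := exists_nat_gt (b / -a)
  rw [div_lt_iff₀ (by linarith)] at hN
  -- `N + 1` rather than `N`: at `N = 0` the expression vanishes and contradicts nothing.
  have h1 := h (N + 1)
  push_cast at h1
  have h2 : (0 : ℝ) ≤ N := N.cast_nonneg
  nlinarith

/-- Letting `N` grow leaves a quadratic in `t` that is nonnegative everywhere, so its discriminant
is at most zero. -/
theorem IsExchangeableSeq.sq_le {ν : Measure (ℕ → ℕ+)} [IsProbabilityMeasure ν]
    (hν : IsExchangeableSeq ν) (k : ℕ) :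
    ν.real (exceedOne (Finset.range (k + 1))) ^ 2 ≤
      ν.real (exceedOne (Finset.range k)) * ν.real (exceedOne (Finset.range (k + 2))) := by
  have h := discrim_le_zero (a := ν.real (exceedOne (Finset.range k)))
    (b := - 2 * ν.real (exceedOne (Finset.range (k + 1))))
    (c := ν.real (exceedOne (Finset.range (k + 2)))) fun t => by
      have := nonneg_of_forall_sq_mul_add_nonneg fun N => hν.quadratic_nonneg k N t
      linarith
  rw [discrim] at h
  linarith

/-- Monotonicity of `b (k + 1) / b k`, free of division. Antitonicity covers zeros: once `b`
vanishes it stays zero. -/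
theorem mul_succ_le_of_sq_le {b : ℕ → ℝ} (h0 : ∀ k, 0 ≤ b k) (hb : Antitone b)
    (h : ∀ k, b (k + 1) ^ 2 ≤ b k * b (k + 2)) {c e : ℕ} (hce : c ≤ e) :
    b (c + 1) * b e ≤ b (e + 1) * b c := by
  induction e, hce using Nat.le_induction with
  | base => exact le_rfl
  | succ e _ ih =>
    rcases (h0 e).eq_or_lt with h1 | h1
    · have : b (e + 1) = 0 := le_antisymm (h1 ▸ hb (Nat.le_succ e)) (h0 _)
      rw [this, mul_zero]
      exact mul_nonneg (h0 _) (h0 _)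
    · refine le_of_mul_le_mul_left ?_ h1
      calc b e * (b (c + 1) * b (e + 1)) = b (c + 1) * b e * b (e + 1) := by ring
        _ ≤ b (e + 1) * b c * b (e + 1) := by gcongr; exact h0 _
        _ = b (e + 1) ^ 2 * b c := by ring
        _ ≤ b e * b (e + 2) * b c := by gcongr; exacts [h0 _, h e]
        _ = b e * (b (e + 1 + 1) * b c) := by ring

/-! ### From factorization and extendibility to MRTI. -/

/-- The joint survival function of a distribution on `ℕ^d`. -/
noncomputable def survival {d : ℕ} (μ : Measure (Fin d → ℕ+)) (n : Fin d → ℕ) : ℝ :=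
  μ.real {x | ∀ i, n i < (x i : ℕ)}

/-- The survival function factorizes over the first time step. -/
def SurvivalFactorizes {d : ℕ} (μ : Measure (Fin d → ℕ+)) : Prop :=
  ∀ n : Fin d → ℕ, survival μ n =
    survival μ (fun i => if 0 < n i then 1 else 0) * survival μ (fun i => n i - 1)

theorem survival_ite_of_map_eq {d : ℕ} {μ : Measure (Fin d → ℕ+)} {ν : Measure (ℕ → ℕ+)}
    (hν : IsExchangeableSeq ν) (hμ : ν.map (fun x (i : Fin d) => x i) = μ)
    (p : Fin d → Prop) [DecidablePred p] :
    survival μ (fun i => if p i then 1 else 0) =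
      ν.real (exceedOne (Finset.range (Finset.univ.filter p).card)) := by
  have hm : Measurable (fun (x : ℕ → ℕ+) (i : Fin d) => x i) :=
    measurable_pi_lambda _ fun i => measurable_pi_apply _
  have := hν.measureReal_exceedOne ((Finset.univ.filter p).map Fin.valEmbedding)
  rw [Finset.card_map] at this
  rw [← this, survival, ← hμ, map_measureReal_apply hm MeasurableSet.of_discrete]
  congr 1
  ext x
  simp only [exceedOne, Set.mem_preimage, Set.mem_ofPred_eq, Finset.mem_map, Finset.mem_filter,
    Finset.mem_univ, true_and, forall_exists_index, and_imp, Fin.valEmbedding_apply]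
  constructor
  · rintro h _ i hi rfl
    simpa [hi] using h i
  · intro h i
    split_ifs with hi
    exacts [h _ i hi rfl, (x i).pos]

/-- Raising coordinate `i` from 0 adds one positive threshold to both `n` and `n'`, so the
first-step factors compare through the growing ratios of `b`; the remaining factors are the
induction hypothesis for thresholds lowered by one. -/
theorem SurvivalFactorizes.survival_update_mul_le {d : ℕ} {μ : Measure (Fin d → ℕ+)}
    (hμ : SurvivalFactorizes μ) (hext : IsExtendible μ) (i : Fin d) (k : ℕ) (n n' : Fin d → ℕ)
    (hn : n ≤ n') (hi : n' i = 0) :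
    survival μ (Function.update n i k) * survival μ n' ≤
      survival μ (Function.update n' i k) * survival μ n := by
  obtain ⟨ν, hprob, hν, hmap⟩ := hext
  have hb : Antitone fun k => ν.real (exceedOne (Finset.range k)) := fun a b hab =>
    measureReal_mono fun x hx j hj => hx j (Finset.range_mono hab hj)
  have hni : n i = 0 := Nat.le_zero.1 (hi ▸ hn i)
  have hcard : ∀ (m : Fin d → ℕ) (k : ℕ), m i = 0 →
      (Finset.univ.filter fun j => 0 < Function.update m i (k + 1) j).card =
        (Finset.univ.filter fun j => 0 < m j).card + 1 := fun m k hm => by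
    rw [← Finset.card_insert_of_notMem (a := i) (s := Finset.univ.filter fun j => 0 < m j)
      (by simp [hm])]
    congr 1
    ext j
    by_cases hj : j = i <;> simp [hj, Function.update]
  have hsub : ∀ (m : Fin d → ℕ) (k : ℕ), (fun j => Function.update m i (k + 1) j - 1) =
      Function.update (fun j => m j - 1) i k := fun m k => by
    ext j
    by_cases hj : j = i
    · subst hj; simp
    · simp [hj]
  induction k generalizing n n' with
  | zero =>
    rw [← hni, Function.update_eq_self, hni, ← hi, Function.update_eq_self, mul_comm]
  | succ k ih =>
    have ih' := ih (fun j => n j - 1) (fun j => n' j - 1)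
      (fun j => Nat.sub_le_sub_right (hn j) 1) (by simp [hi]) (by simp [hni])
    have hle : (Finset.univ.filter fun j => 0 < n j).card ≤
        (Finset.univ.filter fun j => 0 < n' j).card :=
      Finset.card_le_card fun j hj => by
        simp only [Finset.mem_filter, Finset.mem_univ, true_and] at hj ⊢
        exact hj.trans_le (hn j)
    have hc := mul_succ_le_of_sq_le (fun _ => measureReal_nonneg) hb hν.sq_le hle
    rw [hμ (Function.update n i (k + 1)), hμ (Function.update n' i (k + 1)), hμ n, hμ n',
      hsub, hsub]
    simp only [survival_ite_of_map_eq hν hmap, hcard _ _ hni, hcard _ _ hi]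
    have hpos : ∀ m, 0 ≤ survival μ m := fun m => measureReal_nonneg
    have := mul_le_mul hc ih' (mul_nonneg (hpos _) (hpos _))
      (mul_nonneg measureReal_nonneg measureReal_nonneg)
    linarith

theorem tailEvent_eq {d : ℕ} (π : Equiv.Perm (Fin d)) (i : Fin d) (n : Fin d → ℕ) :
    tailEvent π i n = {x | ∀ l, (if π.symm l < i then n (π.symm l) else 0) < (x l : ℕ)} := by
  ext x
  simp only [tailEvent, Set.mem_ofPred_eq]
  constructor
  · intro h l
    split_ifs with hl
    · simpa using h _ hl
    · exact (x l).pos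
  · intro h j hj
    simpa [hj] using h (π j)

theorem tailEvent_inter_eq {d : ℕ} (π : Equiv.Perm (Fin d)) (i : Fin d) (n : Fin d → ℕ) (k : ℕ) :
    tailEvent π i n ∩ {x | k < (x (π i) : ℕ)} = {x | ∀ l, Function.update
      (fun l => if π.symm l < i then n (π.symm l) else 0) (π i) k l < (x l : ℕ)} := by
  rw [tailEvent_eq]
  ext x
  simp only [Set.mem_inter_iff, Set.mem_ofPred_eq]
  constructor
  · rintro ⟨h, hk⟩ l
    by_cases hl : l = π i
    · subst hl; simpa using hk
    · simpa [hl] using h l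
  · intro h
    refine ⟨fun l => ?_, by simpa using h (π i)⟩
    by_cases hl : l = π i
    · subst hl; simp
    · simpa [hl] using h l

theorem SurvivalFactorizes.isMRTI {d : ℕ} {μ : Measure (Fin d → ℕ+)} [IsProbabilityMeasure μ]
    (hμ : SurvivalFactorizes μ) (hext : IsExtendible μ) : IsMRTI μ := by
  intro π i _ k n n' hn hn'
  have hsub : tailEvent π i n' ⊆ tailEvent π i n := fun x hx j hj => (hn j hj).trans_lt (hx j hj)
  have hpos' : 0 < μ.real (tailEvent π i n') :=
    ENNReal.toReal_pos hn' (measure_ne_top _ _)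
  have hpos : 0 < μ.real (tailEvent π i n) := hpos'.trans_le (measureReal_mono hsub)
  rw [← ENNReal.toReal_le_toReal (measure_ne_top _ _) (measure_ne_top _ _)]
  rw [cond_apply MeasurableSet.of_discrete, cond_apply MeasurableSet.of_discrete,
    ENNReal.toReal_mul, ENNReal.toReal_mul, ENNReal.toReal_inv, ENNReal.toReal_inv]
  simp only [← measureReal_def]
  -- Unconditioned coordinates get threshold 0, which is no constraint in `ℕ+`; this gives the zero
  -- at `π i` that the next lemma needs.
  rw [← div_eq_inv_mul, ← div_eq_inv_mul, div_le_div_iff₀ hpos hpos', tailEvent_inter_eq,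
    tailEvent_inter_eq, tailEvent_eq, tailEvent_eq]
  refine hμ.survival_update_mul_le hext (π i) k _ _ (fun l => ?_) (by simp)
  dsimp only
  split_ifs with hl
  exacts [hn _ hl, le_rfl]

/-! ### Factorization for the three kinds of geometric law. -/

theorem LocalLackOfMemory.survivalFactorizes {d : ℕ} {μ : Measure (Fin d → ℕ+)}
    [IsProbabilityMeasure μ] (hμ : LocalLackOfMemory μ) : SurvivalFactorizes μ := by
  intro n
  rcases (Finset.univ.filter fun i => 0 < n i).eq_empty_or_nonempty with hS | hS
  · have h0 : ∀ i, n i = 0 := fun i => by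
      by_contra h
      have : i ∈ Finset.univ.filter fun i => 0 < n i := by simp; omega
      simp [hS] at this
    have : n = fun _ => 0 := funext h0
    subst this
    simp [survival]
  · have hS1 : survivalEvent (Finset.univ.filter fun i => 0 < n i) (fun _ => 1) =
        {x | ∀ i, (if 0 < n i then 1 else 0) < (x i : ℕ)} := by
      ext x
      simp only [survivalEvent, Finset.mem_filter, Finset.mem_univ, true_and, Set.mem_ofPred_eq]
      refine forall_congr' fun i => ?_
      split_ifs with h <;> simp [h]
    have hS2 : survivalEvent (Finset.univ.filter fun i => 0 < n i) (fun i => n i - 1 + 1) =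
        {x | ∀ i, n i < (x i : ℕ)} := by
      ext x
      simp only [survivalEvent, Finset.mem_filter, Finset.mem_univ, true_and, Set.mem_ofPred_eq]
      refine forall_congr' fun i => ?_
      have := (x i).pos
      omega
    have hS3 : survivalEvent (Finset.univ.filter fun i => 0 < n i) (fun i => n i - 1) =
        {x | ∀ i, n i - 1 < (x i : ℕ)} := by
      ext x
      simp only [survivalEvent, Finset.mem_filter, Finset.mem_univ, true_and, Set.mem_ofPred_eq]
      refine forall_congr' fun i => ?_
      have := (x i).pos
      omega
    have hsub : {x : Fin d → ℕ+ | ∀ i, n i < (x i : ℕ)} ⊆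
        {x | ∀ i, (if 0 < n i then 1 else 0) < (x i : ℕ)} := fun x hx i => by
      have : n i < (x i : ℕ) := hx i
      split_ifs <;> omega
    -- One unit of time is forgotten, on the coordinates with positive threshold only.
    have h := hμ _ hS (fun i => n i - 1) 1
    rw [hS1, hS2, hS3] at h
    unfold survival
    by_cases h0 : μ {x | ∀ i, (if 0 < n i then 1 else 0) < (x i : ℕ)} = 0
    · rw [measureReal_def, measureReal_def, h0, measure_mono_null hsub h0]
      simp
    · rw [measureReal_def, measureReal_def, measureReal_def, ← h h0, ← ENNReal.toReal_mul,
        mul_comm, cond_mul_eq_inter MeasurableSet.of_discrete, Set.inter_eq_right.2 hsub]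

/-- A distribution on `ℕ^d` whose point masses are those of a random vector `T` with values in
`(ℕ ∪ {∞})^d` has the same survival function as `T`. -/
theorem survival_eq_of_forall_singleton {d : ℕ} {μ : Measure (Fin d → ℕ+)} [IsProbabilityMeasure μ]
    {Ω : Type} [MeasurableSpace Ω] {P : Measure Ω} [IsProbabilityMeasure P]
    {T : Fin d → Ω → ℕ∞} (hT : ∀ k, Measurable (T k))
    (h : ∀ x : Fin d → ℕ+, μ {x} = P {ω | ∀ k, T k ω = ((x k : ℕ) : ℕ∞)}) (n : Fin d → ℕ) :
    survival μ n = P.real {ω | ∀ k, (n k : ℕ∞) < T k ω} := by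
  let E : (Fin d → ℕ+) → Set Ω := fun x => {ω | ∀ k, T k ω = ((x k : ℕ) : ℕ∞)}
  have hE : ∀ x, MeasurableSet (E x) := fun x => by
    have : E x = ⋂ k, T k ⁻¹' {((x k : ℕ) : ℕ∞)} := by ext; simp [E]
    rw [this]
    exact MeasurableSet.iInter fun k => hT k (measurableSet_singleton _)
  have hdisj : Pairwise (Function.onFun Disjoint E) := fun x y hxy => by
    rw [Function.onFun, Set.disjoint_left]
    intro ω hx hy
    refine hxy (funext fun k => ?_)
    have := (hx k).symm.trans (hy k)
    exact_mod_cast this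
  have hμ : ∀ A : Set (Fin d → ℕ+), μ A = P (⋃ x ∈ A, E x) := fun A => by
    have hs : A.PairwiseDisjoint fun x => ({x} : Set (Fin d → ℕ+)) := fun x _ y _ hxy => by
      simpa [Function.onFun] using hxy
    rw [measure_biUnion A.to_countable (hdisj.set_pairwise _) fun x _ => hE x]
    conv_lhs => rw [← Set.biUnion_of_singleton A]
    rw [measure_biUnion A.to_countable hs fun x _ => measurableSet_singleton x]
    simp only [h, E]
  -- As `μ` has total mass one, `T` is almost surely finite, so infinite values do not affect
  -- survival probabilities.
  have hfull : P (⋃ x, E x) = 1 := by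
    rw [← measure_univ (μ := μ), hμ Set.univ]
    simp
  have hae : ∀ᵐ ω ∂P, ω ∈ ⋃ x, E x :=
    (prob_compl_eq_zero_iff (MeasurableSet.iUnion hE)).2 hfull
  rw [survival, measureReal_def, measureReal_def, hμ]
  congr 1
  refine measure_congr ?_
  filter_upwards [hae] with ω hω
  obtain ⟨y, hy⟩ := Set.mem_iUnion.1 hω
  refine propext ?_
  change ω ∈ (⋃ x ∈ {x : Fin d → ℕ+ | ∀ i, n i < (x i : ℕ)}, E x) ↔ ∀ k, (n k : ℕ∞) < T k ω
  simp only [Set.mem_iUnion, Set.mem_ofPred_eq]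
  constructor
  · rintro ⟨x, hx, hxω⟩ k
    rw [hxω k]
    exact_mod_cast hx k
  · intro hω'
    refine ⟨y, fun k => ?_, hy⟩
    have := hω' k
    rw [hy k] at this
    exact_mod_cast this

theorem measurable_enat_iInf {Ω : Type*} [MeasurableSpace Ω] {ι : Sort*} [Countable ι]
    {f : ι → Ω → ℕ∞} (hf : ∀ i, Measurable (f i)) : Measurable fun ω => ⨅ i, f i ω := by
  have : BorelSpace ℕ∞ := ⟨borel_eq_top_of_countable.symm⟩
  exact Measurable.iInf hf

theorem measurable_firstTrial {Ω : Type} [MeasurableSpace Ω] {d : ℕ}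
    {X : ℕ → Ω → Finset (Fin d)} (hX : ∀ n, Measurable (X n)) (I : Finset (Fin d)) :
    Measurable (firstTrial X I) := by
  unfold firstTrial
  refine measurable_enat_iInf fun n => ?_
  classical
  have : (fun ω => ⨅ (_ : X n ω = I), ((n + 1 : ℕ) : ℕ∞)) =
      fun ω => if X n ω = I then ((n + 1 : ℕ) : ℕ∞) else ⊤ := by
    ext ω; split_ifs with h <;> simp [h]
  rw [this]
  exact Measurable.ite (hX n (measurableSet_singleton I)) measurable_const measurable_const

theorem natCast_lt_firstTrial {Ω : Type} {d : ℕ} {X : ℕ → Ω → Finset (Fin d)}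
    {I : Finset (Fin d)} {ω : Ω} {m : ℕ} :
    (m : ℕ∞) < firstTrial X I ω ↔ ∀ j < m, X j ω ≠ I := by
  rw [← ENat.add_one_le_iff (ENat.natCast_ne_top m), firstTrial]
  simp only [le_iInf_iff]
  constructor
  · intro h j hj hI
    have := h j hI
    norm_cast at this
    omega
  · intro h j hI
    norm_cast
    by_contra hj
    exact h j (by omega) hI

/-- Survival means that trial `j`, counted from 0, avoids every `i` with `j < n i`; trials are
independent. Any bound `N` serves, since trials beyond all thresholds are unconstrained. -/
theorem survival_eq_prod_of_forall_firstTrial {d : ℕ} {μ : Measure (Fin d → ℕ+)}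
    [IsProbabilityMeasure μ] {p : Finset (Fin d) → ℝ≥0}
    (hμ : IsWideSenseGeometricWith p μ) {N : ℕ} {n : Fin d → ℕ} (hn : ∀ i, n i ≤ N) :
    survival μ n = ∏ j ∈ Finset.range N, ((∑ I with ∀ i, j < n i → i ∉ I, p I : ℝ≥0) : ℝ) := by
  obtain ⟨_, _, Ω, _, P, X, hP, hX, hind, hXp, hlaw⟩ := hμ
  rw [survival_eq_of_forall_singleton (P := P) (fun k => ?_) hlaw]
  · have hset : {ω | ∀ k, (n k : ℕ∞) < ⨅ (I : Finset (Fin d)) (_ : k ∈ I), firstTrial X I ω} =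
        ⋂ j ∈ Finset.range N, X j ⁻¹' {I | ∀ i, j < n i → i ∉ I} := by
      ext ω
      -- Strict bounds become `n + 1 ≤ _`, which passes through infima.
      simp only [← ENat.add_one_le_iff (ENat.natCast_ne_top _), Set.mem_ofPred_eq, le_iInf_iff,
        Set.mem_iInter, Set.mem_preimage, Finset.mem_range]
      simp only [ENat.add_one_le_iff (ENat.natCast_ne_top _), natCast_lt_firstTrial]
      constructor
      · intro h j _ i hji hi
        exact h i _ hi j hji rfl
      · rintro h i I hi j hj rfl
        exact h j (hj.trans_le (hn i)) i hj hi
    rw [hset, measureReal_def, hind.measure_inter_preimage_eq_mul _ fun _ _ =>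
      MeasurableSet.of_discrete, ENNReal.toReal_prod]
    refine Finset.prod_congr rfl fun j _ => ?_
    have hu : X j ⁻¹' {I | ∀ i, j < n i → i ∉ I} =
        ⋃ I ∈ (Finset.univ.filter fun I : Finset (Fin d) => ∀ i, j < n i → i ∉ I),
          {ω | X j ω = I} := by
      ext ω; simp
    rw [hu, measure_biUnion_finset]
    · simp only [hXp]
      rw [← ENNReal.ofNNReal_finsetSum, ENNReal.coe_toReal]
    · intro I _ J _ hIJ
      rw [Function.onFun, Set.disjoint_left]
      rintro ω hI hJ
      exact hIJ (hI.symm.trans hJ)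
    · exact fun I _ => hX j (measurableSet_singleton I)
  · exact measurable_enat_iInf fun I => measurable_enat_iInf fun _ => measurable_firstTrial hX I

theorem IsWideSenseGeometric.survivalFactorizes {d : ℕ} {μ : Measure (Fin d → ℕ+)}
    [IsProbabilityMeasure μ] (hμ : IsWideSenseGeometric μ) : SurvivalFactorizes μ := by
  obtain ⟨p, hp⟩ := hμ
  intro n
  have hN : ∀ i, n i ≤ Finset.univ.sup n := fun i => Finset.le_sup (Finset.mem_univ i)
  rw [survival_eq_prod_of_forall_firstTrial hp (N := Finset.univ.sup n + 1) (n := n)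
      fun i => (hN i).trans (Nat.le_succ _),
    survival_eq_prod_of_forall_firstTrial hp (N := 1) fun i => by split_ifs <;> simp,
    survival_eq_prod_of_forall_firstTrial hp (N := Finset.univ.sup n) (n := fun i => n i - 1)
      fun i => (Nat.sub_le _ _).trans (hN i),
    -- Trial 0 is split off as the first-step factor; the others shift down by one.
    Finset.prod_range_succ', mul_comm]
  congr 1
  · rw [Finset.prod_range_one]
    have : ∀ i, (0 < if 0 < n i then 1 else 0) ↔ 0 < n i := fun i => by split_ifs <;> simp [*]
    simp only [this]
  · have : ∀ j i, j < n i - 1 ↔ j + 1 < n i := fun j i => by omega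
    simp only [this]

/-- Shock `E I` must outlast the largest threshold in `I`, independently of the others. -/
theorem survival_eq_prod_of_narrowSense {d : ℕ} {μ : Measure (Fin d → ℕ+)}
    [IsProbabilityMeasure μ] {p : {I : Finset (Fin d) // I.Nonempty} → ℝ≥0}
    (hμ : IsNarrowSenseGeometricWith p μ) (n : Fin d → ℕ) :
    survival μ n = ∏ I, (p I : ℝ) ^ I.1.sup n := by
  obtain ⟨_, _, Ω, _, P, E, hP, hE, hind, hEp, hlaw⟩ := hμ
  rw [survival_eq_of_forall_singleton (P := P) (fun k => ?_) hlaw]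
  · have hset : {ω | ∀ k, (n k : ℕ∞) <
          ⨅ (I : {I : Finset (Fin d) // I.Nonempty}) (_ : k ∈ I.1), E I ω} =
        ⋂ I ∈ Finset.univ, E I ⁻¹' {a | ((I.1.sup n : ℕ) : ℕ∞) < a} := by
      ext ω
      simp only [← ENat.add_one_le_iff (ENat.natCast_ne_top _), Set.mem_ofPred_eq, le_iInf_iff,
        Set.mem_iInter, Set.mem_preimage, Finset.mem_univ, true_implies]
      simp only [ENat.add_one_le_iff (ENat.natCast_ne_top _)]
      constructor
      · intro h I
        obtain ⟨i, hi, hie⟩ := I.1.exists_mem_eq_sup I.2 n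
        rw [hie]
        exact h i I hi
      · intro h i I hi
        refine lt_of_le_of_lt ?_ (h I)
        exact_mod_cast Finset.le_sup hi
    rw [hset, measureReal_def, hind.measure_inter_preimage_eq_mul _ fun _ _ =>
      MeasurableSet.of_discrete, ENNReal.toReal_prod]
    refine Finset.prod_congr rfl fun I _ => ?_
    change (P {ω | ((I.1.sup n : ℕ) : ℕ∞) < E I ω}).toReal = _
    rw [hEp, ENNReal.toReal_pow, ENNReal.coe_toReal]
  · exact measurable_enat_iInf fun I => measurable_enat_iInf fun _ => hE I

theorem IsNarrowSenseGeometric.survivalFactorizes {d : ℕ} {μ : Measure (Fin d → ℕ+)}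
    [IsProbabilityMeasure μ] (hμ : IsNarrowSenseGeometric μ) : SurvivalFactorizes μ := by
  obtain ⟨p, hp⟩ := hμ
  intro n
  simp only [survival_eq_prod_of_narrowSense hp, ← Finset.prod_mul_distrib, ← pow_add]
  refine Finset.prod_congr rfl fun I _ => ?_
  congr 1
  -- The exponents agree because a maximum `M` of thresholds splits as `min M 1 + (M - 1)`, and both
  -- summands are monotone in `M`.
  obtain ⟨i, hi, hie⟩ := I.1.exists_mem_eq_sup I.2 n
  obtain ⟨j, hj, hje⟩ := I.1.exists_mem_eq_sup I.2 fun i => if 0 < n i then 1 else 0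
  obtain ⟨l, hl, hle⟩ := I.1.exists_mem_eq_sup I.2 fun i => n i - 1
  have h1 := Finset.le_sup (f := n) hj
  have h2 := Finset.le_sup (f := n) hl
  have h3 := Finset.le_sup (f := fun i => if 0 < n i then 1 else 0) hi
  have h4 := Finset.le_sup (f := fun i => n i - 1) hi
  split_ifs at h3 hje <;> omega

end MultGeom

theorem corollary20 (d : ℕ) (μ : Measure (Fin d → ℕ+)) [IsProbabilityMeasure μ]
    (hgeo : MultGeom.LocalLackOfMemory μ ∨ MultGeom.IsWideSenseGeometric μ ∨
      MultGeom.IsNarrowSenseGeometric μ)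
    (hext : MultGeom.IsExtendible μ) :
    MultGeom.IsMRTI μ := by
  rcases hgeo with h | h | h
  · exact h.survivalFactorizes.isMRTI hext
  · exact h.survivalFactorizes.isMRTI hext
  · exact h.survivalFactorizes.isMRTI hext
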